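/- Let $n\ge 4$ and let $R=\{\pm\varepsilon_i\pm\varepsilon_j : 1\le i<j\le n\}$ be the root system of type $D_n$, with positive roots $R^+=\{\varepsilon_i\pm\varepsilon_j : i<j\}$, simple roots $\alpha_i=\varepsilon_i-\varepsilon_{i+1}$ $(1\le i\le n-1)$ and $\alpha_n=\varepsilon_{n-1}+\varepsilon_n$, and Weyl group $W$ generated by the simple reflections $s_1,\dots,s_n$. Write $\lambda\ge\mu$ if $\lambda-\mu$ is a nonnegative integral linear combination of simple roots. Let $r\in\{1,n-1,n\}$ and let $w\in W$ be such that $\{\,i : w(\alpha_i)\in R^+\}=\{1,\dots,n\}\setminus\{r\}$ (that is, $w$ is a minuscule element with $P^w=P^{\alpha_r}$). Let $(s_{i_1},\dots,s_{i_k})$ be a reduced decomposition of $w$ and $\beta_j=\alpha_{i_j}$. The quiver $Q_w$ has vertex set $[1,k]$, and an arrow from $i$ to $j$ whenever $\langle\beta_j^\vee,\beta_i\rangle\ne 0$, $i<j$, and $j<s(i)$ if $s(i):=\min\{l>i : \beta_l=\beta_i\}$ exists. For $Q_w$ or a full subquiver $Q$ of it, let $\preceq_Q$ be the partial order on the vertices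 of $Q$ generated by $i\preceq_Q j$ for each arrow $i\to j$ of $Q$; the peaks of $Q$ are its $\preceq_Q$-minimal vertices. For a peak $p$ of $Q$, let $Q(p)$ be the full subquiver of $Q$ on the vertices $i$ with $j\not\preceq_Q i$ for every peak $j\ne p$ of $Q$. Choose an arbitrary ordering $(p_1,\dots,p_m)$ of the peaks of $Q_w$, put $Q_0=Q_w$, and for $1\le j\le m$ let $Q_j$ be obtained from $Q_{j-1}$ by removing the vertices of $Q_{j-1}(p_j)$. Let $w'_j$ be the product, in increasing order of the vertices $i$ of $Q_{j-1}(p_j)$, of the simple reflections $s_{\beta_i}$. The sequence $(w'_1,\dots,w'_m)$ is the generalised reduced decomposition of $w$ obtained by construction 1 for the chosen ordering. Then there is a unique simple root $\alpha$ such that $(w'_1)^{-1}(\alpha)$ is a negative root, and for this $\alpha$ we have $$(w'_1)^{-1}(\alpha)\ \ge\ w^{-1}(\alpha).$$ Further, $(w'_1)^{-1}(\alpha)=w^{-1}(\alpha)$ if and only if $w=w'_1$; and $w=w'_1$ if and only if $m=1$. -/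

import Mathlib

/-! The root system of type `D_n` inside `ℤⁿ` (simple roots numbered as usual, with
indices shifted to `0, …, n - 1`), its Weyl group, the quiver of a reduced word, and the
decomposition of a minuscule element attached to an ordering of the peaks of its quiver. -/

namespace TypeD

variable {n : ℕ}

/-- The simple roots `ε_i - ε_{i+1}` for `i + 1 < n`, and `ε_{n-2} + ε_{n-1}` for the last index
(indices start at `0`). -/
def simpleRoot (i : Fin n) : Fin n → ℤ :=
  if h : (i : ℕ) + 1 < n then Pi.single i 1 - Pi.single ⟨i + 1, h⟩ 1
  else Pi.single ⟨i - 1, by omega⟩ 1 + Pi.single i 1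

/-- The positive roots `ε_i ± ε_j`, `i < j`. -/
def IsPositiveRoot (v : Fin n → ℤ) : Prop :=
  ∃ i j : Fin n, i < j ∧
    (v = Pi.single i 1 - Pi.single j 1 ∨ v = Pi.single i 1 + Pi.single j 1)

/-- The negative roots. -/
def IsNegativeRoot (v : Fin n → ℤ) : Prop := IsPositiveRoot (-v)

/-- `RootLE μ l` means `μ ≤ l`: the difference `l - μ` is a nonnegative integral linear
combination of simple roots. -/
def RootLE (μ l : Fin n → ℤ) : Prop :=
  ∃ c : Fin n → ℕ, l - μ = ∑ i, c i • simpleRoot i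

theorem simpleRoot_dotProduct_self (hn : 4 ≤ n) (i : Fin n) :
    simpleRoot i ⬝ᵥ simpleRoot i = 2 := by
  unfold simpleRoot
  split_ifs with h
  · have h1 : i ≠ ⟨i + 1, h⟩ := by
      intro h'
      have := congrArg Fin.val h'
      simp at this
    simp [h1, h1.symm]
  · have h1 : (⟨i - 1, by omega⟩ : Fin n) ≠ i := by
      intro h'
      have := congrArg Fin.val h'
      simp at this
      omega
    simp [h1, h1.symm]

/-- The simple reflection `s_i : v ↦ v - (α_i · v) α_i`. All roots have square length `2`, so
that a root is identified with its coroot by the dot product. -/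
def simpleReflection (hn : 4 ≤ n) (i : Fin n) : (Fin n → ℤ) ≃ₗ[ℤ] (Fin n → ℤ) :=
  Module.reflection (x := simpleRoot i) (f := dotProductBilin ℤ ℤ (simpleRoot i))
    (simpleRoot_dotProduct_self hn i)

theorem simpleReflection_apply (hn : 4 ≤ n) (i : Fin n) (v : Fin n → ℤ) :
    simpleReflection hn i v = v - (simpleRoot i ⬝ᵥ v) • simpleRoot i := rfl

/-- The Weyl group, generated by the simple reflections. -/
def weylGroup (hn : 4 ≤ n) : Subgroup ((Fin n → ℤ) ≃ₗ[ℤ] (Fin n → ℤ)) :=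
  Subgroup.closure (Set.range (simpleReflection hn))

/-- The product `s_{i_1} ⋯ s_{i_k}` of a word. -/
def wordProd (hn : 4 ≤ n) (t : List (Fin n)) : (Fin n → ℤ) ≃ₗ[ℤ] (Fin n → ℤ) :=
  (t.map (simpleReflection hn)).prod

/-- `t` is a reduced decomposition of `w`: it has product `w` and minimal length among the words
with product `w`. -/
def IsReducedWord (hn : 4 ≤ n) (t : List (Fin n)) (w : (Fin n → ℤ) ≃ₗ[ℤ] (Fin n → ℤ)) : Prop :=
  wordProd hn t = w ∧ ∀ t' : List (Fin n), wordProd hn t' = w → t.length ≤ t'.length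

/-- The set `I^w` of (indices of) simple roots that `w` maps to positive roots. -/
def stableSimpleRoots (w : (Fin n → ℤ) ≃ₗ[ℤ] (Fin n → ℤ)) : Set (Fin n) :=
  {i | IsPositiveRoot (w (simpleRoot i))}

/-- The minuscule simple roots `α_1`, `α_{n-1}`, `α_n` in the numbering that starts at `1`. -/
def IsMinusculeIndex (r : Fin n) : Prop :=
  (r : ℕ) + 1 = 1 ∨ (r : ℕ) + 1 = n - 1 ∨ (r : ℕ) + 1 = n

/-- `j` is the successor `s(i)` of the position `i` in the word `t`. -/
def IsSuccessor (t : List (Fin n)) (i j : Fin t.length) : Prop :=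
  IsLeast {l : Fin t.length | i < l ∧ t.get l = t.get i} j

/-- There is an arrow `i → j` in the quiver of the word `t`. -/
def Arrow (t : List (Fin n)) (i j : Fin t.length) : Prop :=
  simpleRoot (t.get j) ⬝ᵥ simpleRoot (t.get i) ≠ 0 ∧ i < j ∧ ∀ s, IsSuccessor t i s → j < s

/-- The partial order generated by the arrows of the full subquiver with vertex set `V`. -/
def QuiverOrder (t : List (Fin n)) (V : Set (Fin t.length)) : Fin t.length → Fin t.length → Prop :=
  Relation.ReflTransGen fun i j => i ∈ V ∧ j ∈ V ∧ Arrow t i j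

/-- The peaks of the full subquiver with vertex set `V`: its minimal vertices. -/
def peaks (t : List (Fin n)) (V : Set (Fin t.length)) : Set (Fin t.length) :=
  {i | i ∈ V ∧ ∀ j ∈ V, QuiverOrder t V j i → j = i}

/-- The vertex set of `Q(A)`, where `Q` is the full subquiver with vertex set `V` and `A` is a set
of peaks of `Q`: the vertices that do not lie above a peak outside `A`. -/
def subquiver (t : List (Fin n)) (V A : Set (Fin t.length)) : Set (Fin t.length) :=
  {i | i ∈ V ∧ ∀ j ∈ peaks t V \ A, ¬ QuiverOrder t V j i}

/-- The successive vertex sets cut out of `V` for a list of peaks: `Q(A_1)` with `A_1 = {p_1}`,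
then the same for `p_2, p_3, …` in the quiver with the vertices of `Q(A_1)` removed. -/
def pieces (t : List (Fin n)) :
    Set (Fin t.length) → List (Fin t.length) → List (Set (Fin t.length))
  | _, [] => []
  | V, p :: ps => subquiver t V {p} :: pieces t (V \ subquiver t V {p}) ps

open Classical in
/-- The Weyl group element of a set of vertices: the product, in increasing order of the
positions, of the corresponding simple reflections. -/
noncomputable def pieceProd (hn : 4 ≤ n) (t : List (Fin n)) (V : Set (Fin t.length)) :
    (Fin n → ℤ) ≃ₗ[ℤ] (Fin n → ℤ) :=
  wordProd hn (((List.finRange t.length).filter fun i => i ∈ V).map t.get)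

/-- `ws = (w_1, …, w_m)` is a generalised reduced decomposition of `w` obtained by Perrin's
construction 1: from some reduced decomposition `t` of `w` and some ordering of the peaks of the
quiver of `t`. -/
def IsConstructionOne (hn : 4 ≤ n) (w : (Fin n → ℤ) ≃ₗ[ℤ] (Fin n → ℤ))
    (ws : List ((Fin n → ℤ) ≃ₗ[ℤ] (Fin n → ℤ))) : Prop :=
  ∃ (t : List (Fin n)) (order : List (Fin t.length)),
    IsReducedWord hn t w ∧ order.Nodup ∧ (∀ i, i ∈ order ↔ i ∈ peaks t Set.univ) ∧
    ws = (pieces t Set.univ order).map (pieceProd hn t)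

end TypeD

/-! The roots of type `D_n` are the integral vectors of square length `2`, and a root is positive
when its height, the pairing with `rho`, is positive. The proof uses little else about type `D_n`:
for a minuscule `α_r` every root has `α_r`-coefficient at most `1`. As `w` keeps the other simple
roots positive, every inversion of `w` (positive root made negative by `w`) has `α_r`-coefficient
exactly `1`, so two inversions never have negative inner product: their sum would be a root with
coefficient `2`. The same holds for the inversions of `w⁻¹`, which are the images of those of `w`
under `-w`.

*Uniqueness of `α`.* This positivity forces a left descent of a prefix of a reduced word to be a
letter orthogonal to all letters before it (`IsReducedWord.exists_split_of_descent`). The vertices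
of `Q(p)` form a down-closed set with `p` as its only peak, so `w = w₁ u` with reduced words for the
factors read off from `Q(p)` and its complement (`IsReducedWord.subword_append`), and `p` carries
the only left descent `α` of `w₁`.

*Inequality.* Put `γ = -w₁⁻¹ α`, so that `-w⁻¹ α = u⁻¹ γ`. Applying the letters of `u` to `γ` one
by one, each step adds a multiple of a simple root, and the multiplicity is an inner product of
two inversions, hence nonnegative (`IsReducedWord.exists_inv_eq_sub_sum`).

*Equality.* If nothing is added, `γ` is orthogonal to all letters of `u`, hence to all inversions
of `u`. If `u` is not trivial, its first letter is another peak and gives an inversion `δ` of `u`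
orthogonal to `γ`. Then `γ - δ = X - Y` for disjoint nonnegative combinations `X`, `Y` of simple
roots, and comparing lengths in the even root lattice shows that `X` and `Y` are roots. The meet
`γ - X = δ - Y` of `γ` and `δ` is an inversion of `u` with inner product `1` with `γ`, which is a
contradiction (`IsReducedWord.not_orthogonal`). Finally `w = w₁` means that `Q(p)` is the whole quiver, by
minimality of the length of a reduced word, i.e. that `p` is the only peak. -/

namespace TypeD

variable {n : ℕ}

/-! ### Roots as integral vectors of square length two -/

/-- Half the sum of the positive roots. Its pairing with a vector of the root lattice is the
height of that vector. -/
def rho : Fin n → ℤ := fun i => n - 1 - i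

theorem dotProduct_self_nonneg (v : Fin n → ℤ) : 0 ≤ v ⬝ᵥ v :=
  Finset.sum_nonneg fun i _ => mul_self_nonneg (v i)

theorem rho_simpleRoot (hn : 4 ≤ n) (i : Fin n) : rho ⬝ᵥ simpleRoot i = 1 := by
  unfold simpleRoot
  split_ifs with h
  · simp [rho, dotProduct_sub]
  · have : (i : ℕ) = n - 1 := by omega
    simp only [dotProduct_add, dotProduct_single, rho, mul_one, this]
    zify [show 1 ≤ n by omega, show 1 ≤ n - 1 by omega]
    ring

theorem IsPositiveRoot.rho_pos {v : Fin n → ℤ} (hv : IsPositiveRoot v) : 0 < rho ⬝ᵥ v := by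
  obtain ⟨i, j, hij, rfl | rfl⟩ := hv
  · simp only [dotProduct_sub, dotProduct_single, rho, mul_one]
    have : (i : ℕ) < j := hij
    omega
  · simp only [dotProduct_add, dotProduct_single, rho, mul_one]
    have : (i : ℕ) < j := hij
    omega

theorem isPositiveRoot_or_isNegativeRoot {v : Fin n → ℤ} (hv : v ⬝ᵥ v = 2) :
    IsPositiveRoot v ∨ IsNegativeRoot v := by
  classical
  have key : ∀ (s : Finset (Fin n)), 0 < ∑ k ∈ s, v k * v k → ∑ k ∈ s, v k * v k ≤ 2 →
      ∃ i ∈ s, (v i = 1 ∨ v i = -1) ∧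
        ∑ k ∈ s.erase i, v k * v k = ∑ k ∈ s, v k * v k - 1 := by
    intro s h0 h2
    obtain ⟨i, his, hi⟩ := Finset.exists_ne_zero_of_sum_ne_zero h0.ne'
    have hsum : v i * v i + ∑ k ∈ s.erase i, v k * v k = ∑ k ∈ s, v k * v k :=
      Finset.add_sum_erase s (fun k => v k * v k) his
    have h3 : 0 ≤ ∑ k ∈ s.erase i, v k * v k :=
      Finset.sum_nonneg fun k _ => mul_self_nonneg (v k)
    have hle : v i * v i ≤ 2 := by linarith
    have hub : v i ≤ 1 := by nlinarith
    have hlb : -1 ≤ v i := by nlinarith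
    have hne : v i ≠ 0 := fun h => hi (by simp [h])
    have hcase : v i = 1 ∨ v i = -1 := by omega
    refine ⟨i, his, hcase, ?_⟩
    have : v i * v i = 1 := by rcases hcase with h | h <;> simp [h]
    linarith
  have hv' : ∑ k, v k * v k = 2 := hv
  obtain ⟨i, -, hi, h1⟩ := key Finset.univ (by omega) (by omega)
  obtain ⟨j, hj, hj1, h2⟩ := key (Finset.univ.erase i) (by omega) (by omega)
  have hji : j ≠ i := Finset.ne_of_mem_erase hj
  have h0 : ∀ k, k ≠ i → k ≠ j → v k = 0 := by
    intro k hki hkj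
    have := (Finset.sum_eq_zero_iff_of_nonneg (fun k _ => mul_self_nonneg (v k))).1
      (show ∑ k ∈ (Finset.univ.erase i).erase j, v k * v k = 0 by omega) k (by simp [hki, hkj])
    exact mul_self_eq_zero.1 this
  have hveq : v = Pi.single i (v i) + Pi.single j (v j) := by
    funext k
    by_cases hki : k = i
    · subst hki; simp [hji.symm]
    · by_cases hkj : k = j
      · subst hkj; simp [hji]
      · simp [hki, hkj, h0 k hki hkj]
  have aux : ∀ (i j : Fin n) (a b : ℤ), i < j → (a = 1 ∨ a = -1) → (b = 1 ∨ b = -1) →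
      v = Pi.single i a + Pi.single j b → IsPositiveRoot v ∨ IsNegativeRoot v := by
    rintro i j a b hij (rfl | rfl) (rfl | rfl) h
    · exact Or.inl ⟨i, j, hij, Or.inr h⟩
    · exact Or.inl ⟨i, j, hij, Or.inl (by rw [h, Pi.single_neg, sub_eq_add_neg])⟩
    · exact Or.inr ⟨i, j, hij, Or.inl (by rw [h, Pi.single_neg]; abel)⟩
    · exact Or.inr ⟨i, j, hij, Or.inr (by rw [h, Pi.single_neg, Pi.single_neg]; abel)⟩
  rcases lt_or_gt_of_ne hji with h | h
  · exact aux j i _ _ h hj1 hi (by rw [hveq.trans (add_comm _ _)]; simp [hji, hji.symm])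
  · exact aux i j _ _ h hi hj1 hveq

theorem rho_ne_zero {v : Fin n → ℤ} (hv : v ⬝ᵥ v = 2) : rho ⬝ᵥ v ≠ 0 := by
  rcases isPositiveRoot_or_isNegativeRoot hv with h | h
  · exact h.rho_pos.ne'
  · have := IsPositiveRoot.rho_pos h
    rw [dotProduct_neg] at this
    omega

theorem isPositiveRoot_iff {v : Fin n → ℤ} (hv : v ⬝ᵥ v = 2) :
    IsPositiveRoot v ↔ 0 < rho ⬝ᵥ v := by
  refine ⟨IsPositiveRoot.rho_pos, fun h => ?_⟩
  refine (isPositiveRoot_or_isNegativeRoot hv).resolve_right fun h' => ?_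
  have := IsPositiveRoot.rho_pos h'
  rw [dotProduct_neg] at this
  omega

theorem isNegativeRoot_iff {v : Fin n → ℤ} (hv : v ⬝ᵥ v = 2) :
    IsNegativeRoot v ↔ rho ⬝ᵥ v < 0 := by
  rw [IsNegativeRoot, isPositiveRoot_iff (by simpa using hv), dotProduct_neg, neg_pos]

theorem dotProduct_le_two {u v : Fin n → ℤ} (hu : u ⬝ᵥ u = 2) (hv : v ⬝ᵥ v = 2) :
    u ⬝ᵥ v ≤ 2 := by
  have := dotProduct_self_nonneg (u - v)
  rw [sub_dotProduct, dotProduct_sub, dotProduct_sub, dotProduct_comm v u, hu, hv] at this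
  omega

theorem eq_of_dotProduct_eq_two {u v : Fin n → ℤ} (hu : u ⬝ᵥ u = 2) (hv : v ⬝ᵥ v = 2)
    (huv : u ⬝ᵥ v = 2) : u = v := by
  rw [← sub_eq_zero, ← dotProduct_self_eq_zero, sub_dotProduct, dotProduct_sub, dotProduct_sub,
    dotProduct_comm v u, hu, hv, huv]
  norm_num

theorem dotProduct_le_one {u v : Fin n → ℤ} (hu : u ⬝ᵥ u = 2) (hv : v ⬝ᵥ v = 2)
    (huv : u ≠ v) : u ⬝ᵥ v ≤ 1 := by
  have h1 := dotProduct_le_two hu hv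
  have h2 : u ⬝ᵥ v ≠ 2 := fun h => huv (eq_of_dotProduct_eq_two hu hv h)
  omega

theorem simpleRoot_injective (hn : 4 ≤ n) : Function.Injective (simpleRoot (n := n)) := by
  have key : ∀ i j : Fin n, i < j → simpleRoot i ≠ simpleRoot j := by
    intro i j hij h
    have hij' : (i : ℕ) < j := hij
    have hi : (i : ℕ) + 1 < n := by omega
    have h1 := congrFun h i
    have h2 := congrFun h ⟨n - 1, by omega⟩
    simp only [simpleRoot, hi, dite_true] at h1 h2
    split_ifs at h1 h2 with hj <;>
      simp [Pi.single_apply, Fin.ext_iff] at h1 h2 <;> omega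
  intro i j h
  by_contra hne
  rcases lt_or_gt_of_ne hne with h' | h'
  · exact key i j h' h
  · exact key j i h' h.symm

theorem simpleRoot_dotProduct_nonpos (hn : 4 ≤ n) {i j : Fin n} (hij : i ≠ j) :
    simpleRoot i ⬝ᵥ simpleRoot j ≤ 0 := by
  have hi := simpleRoot_dotProduct_self hn i
  have hj := simpleRoot_dotProduct_self hn j
  have h1 := dotProduct_le_one hi hj fun h => hij (simpleRoot_injective hn h)
  by_contra! h0
  -- Otherwise the difference of the two simple roots would be a root of height zero.
  refine rho_ne_zero (v := simpleRoot i - simpleRoot j) ?_ ?_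
  · rw [sub_dotProduct, dotProduct_sub, dotProduct_sub, dotProduct_comm (simpleRoot j), hi, hj]
    omega
  · rw [dotProduct_sub, rho_simpleRoot hn, rho_simpleRoot hn, sub_self]

theorem simpleRoot_dotProduct_eq_neg_one (hn : 4 ≤ n) {i j : Fin n} (hij : i ≠ j)
    (h : simpleRoot i ⬝ᵥ simpleRoot j ≠ 0) : simpleRoot i ⬝ᵥ simpleRoot j = -1 := by
  have hi := simpleRoot_dotProduct_self hn i
  have hj := simpleRoot_dotProduct_self hn j
  have h0 := simpleRoot_dotProduct_nonpos hn hij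
  have h1 : -simpleRoot i ⬝ᵥ simpleRoot j ≤ 1 := by
    refine dotProduct_le_one (by simpa using hi) hj fun h => ?_
    have := congrArg (rho ⬝ᵥ ·) h
    simp only [dotProduct_neg, rho_simpleRoot hn] at this
    omega
  rw [neg_dotProduct] at h1
  omega

theorem IsPositiveRoot.exists_eq_sum (hn : 4 ≤ n) {v : Fin n → ℤ} (hv : IsPositiveRoot v) :
    ∃ c : Fin n → ℕ, v = ∑ i, c i • simpleRoot i := by
  classical
  let N : AddSubmonoid (Fin n → ℤ) := AddSubmonoid.closure (Set.range simpleRoot)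
  have hsub : ∀ (d : ℕ) (i j : Fin n), (j : ℕ) = i + d →
      (Pi.single i 1 - Pi.single j 1 : Fin n → ℤ) ∈ N := by
    intro d
    induction d with
    | zero =>
      intro i j h
      rw [show i = j from Fin.ext (by omega), sub_self]
      exact N.zero_mem
    | succ d ih =>
      intro i j h
      have hi : (i : ℕ) + 1 < n := by omega
      have h1 := ih ⟨i + 1, hi⟩ j (by simp only; omega)
      have h2 : simpleRoot i ∈ N := AddSubmonoid.subset_closure ⟨i, rfl⟩
      simp only [simpleRoot, hi, dite_true] at h2
      simpa using N.add_mem h2 h1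
  have hmem : v ∈ N := by
    obtain ⟨i, j, hij, rfl | rfl⟩ := hv
    · have : (i : ℕ) < j := hij
      exact hsub (j - i) i j (by omega)
    · have hij' : (i : ℕ) < j := hij
      have h1 := hsub (n - 2 - i) i ⟨n - 2, by omega⟩ (by simp only; omega)
      have h2 := hsub (n - 1 - j) j ⟨n - 1, by omega⟩ (by simp only; omega)
      have h3 : simpleRoot (⟨n - 1, by omega⟩ : Fin n) ∈ N := AddSubmonoid.subset_closure ⟨_, rfl⟩
      have h4 : ¬ n - 1 + 1 < n := by omega
      have h5 : n - 1 - 1 = n - 2 := by omega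
      simp only [simpleRoot, h4, dite_false, h5] at h3
      convert N.add_mem (N.add_mem h1 h2) h3 using 1
      abel
  refine AddSubmonoid.closure_induction
    (motive := fun v _ => ∃ c : Fin n → ℕ, v = ∑ i, c i • simpleRoot i) ?_ ?_ ?_ hmem
  · rintro _ ⟨i, rfl⟩
    exact ⟨Pi.single i 1, by simp [Pi.single_apply, ite_smul]⟩
  · exact ⟨0, by simp⟩
  · rintro _ _ - - ⟨c, rfl⟩ ⟨d, rfl⟩
    exact ⟨c + d, by simp [add_smul, Finset.sum_add_distrib]⟩

/-- `ϖ` is twice the fundamental weight of a minuscule simple root `α_r`: it reads off twice the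
`α_r`-coefficient, which is at most `1` on every root. The factor `2` keeps the weight integral. -/
structure IsDoubledMinusculeWeight (ϖ : Fin n → ℤ) (r : Fin n) : Prop where
  dotProduct_self : ϖ ⬝ᵥ simpleRoot r = 2
  dotProduct_of_ne : ∀ i, i ≠ r → ϖ ⬝ᵥ simpleRoot i = 0
  dotProduct_le : ∀ v : Fin n → ℤ, v ⬝ᵥ v = 2 → ϖ ⬝ᵥ v ≤ 2

theorem IsMinusculeIndex.exists_weight (hn : 4 ≤ n) {r : Fin n} (hr : IsMinusculeIndex r) :
    ∃ ϖ : Fin n → ℤ, IsDoubledMinusculeWeight ϖ r := by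
  -- A vector with entries `±1` pairs with `v` to at most `∑ |v i| ≤ ∑ (v i)²`.
  have key : ∀ ϖ : Fin n → ℤ, (∀ i, ϖ i = 1 ∨ ϖ i = -1) →
      ∀ v : Fin n → ℤ, v ⬝ᵥ v = 2 → ϖ ⬝ᵥ v ≤ 2 := by
    intro ϖ hϖ v hv
    rw [← hv]
    refine Finset.sum_le_sum fun i _ => ?_
    have hsq : v i ≤ v i * v i ∧ -v i ≤ v i * v i := by
      constructor
      · nlinarith [Int.le_self_sq (v i)]
      · nlinarith [Int.le_self_sq (-v i)]
    rcases hϖ i with h | h <;> rw [h] <;> omega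
  rcases hr with hr | hr | hr
  · refine ⟨Pi.single r 2, ⟨?_, ?_, ?_⟩⟩
    · have : (r : ℕ) + 1 < n := by omega
      simp [simpleRoot, this, Fin.ext_iff]
    · intro i hi
      have hi' : (i : ℕ) ≠ r := fun h => hi (Fin.ext h)
      simp only [simpleRoot]
      split_ifs <;> simp [Pi.single_apply, Fin.ext_iff] <;> omega
    · intro v hv
      have h1 : v r * v r ≤ v ⬝ᵥ v :=
        Finset.single_le_sum (f := fun i => v i * v i) (fun i _ => mul_self_nonneg (v i))
          (Finset.mem_univ r)
      rw [single_dotProduct]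
      nlinarith
  · refine ⟨fun i => if (i : ℕ) = n - 1 then -1 else 1, ⟨?_, ?_, ?_⟩⟩
    · have h1 : (r : ℕ) + 1 < n := by omega
      have h2 : ¬ (r : ℕ) = n - 1 := by omega
      rw [simpleRoot, dif_pos h1]
      simp [dotProduct_sub, h2, hr]
    · intro i hi
      have hi' : (i : ℕ) ≠ r := fun h => hi (Fin.ext h)
      simp only [simpleRoot]
      split_ifs with h
      · have h1 : ¬ (i : ℕ) = n - 1 := by omega
        have h2 : ¬ (i : ℕ) + 1 = n - 1 := by omega
        simp [dotProduct_sub, h1, h2]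
      · have h1 : (i : ℕ) = n - 1 := by omega
        have h2 : ¬ (n - 1 - 1 = n - 1) := by omega
        simp [dotProduct_add, h1, h2]
    · exact key _ fun i => by split_ifs <;> simp
  · refine ⟨fun _ => 1, ⟨?_, ?_, key _ fun i => Or.inl rfl⟩⟩
    · simp [simpleRoot, hr, dotProduct_add]
    · intro i hi
      have hi' : (i : ℕ) ≠ r := fun h => hi (Fin.ext h)
      have h1 : (i : ℕ) + 1 < n := by omega
      simp [simpleRoot, h1, dotProduct_sub]

/-! ### Words in the simple reflections -/

theorem simpleReflection_dotProduct (hn : 4 ≤ n) (i : Fin n) (u v : Fin n → ℤ) :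
    simpleReflection hn i u ⬝ᵥ simpleReflection hn i v = u ⬝ᵥ v := by
  simp only [simpleReflection_apply, sub_dotProduct, dotProduct_sub, smul_dotProduct,
    dotProduct_smul, simpleRoot_dotProduct_self hn i, dotProduct_comm u (simpleRoot i), smul_eq_mul]
  ring

theorem simpleReflection_simpleRoot (hn : 4 ≤ n) (i : Fin n) :
    simpleReflection hn i (simpleRoot i) = -simpleRoot i := by
  rw [simpleReflection_apply, simpleRoot_dotProduct_self hn i, two_smul]
  abel

theorem simpleReflection_of_orthogonal (hn : 4 ≤ n) {i : Fin n} {v : Fin n → ℤ}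
    (h : simpleRoot i ⬝ᵥ v = 0) : simpleReflection hn i v = v := by
  rw [simpleReflection_apply, h, zero_smul, sub_zero]

theorem simpleReflection_simpleReflection (hn : 4 ≤ n) (i : Fin n) (v : Fin n → ℤ) :
    simpleReflection hn i (simpleReflection hn i v) = v :=
  Module.involutive_reflection (simpleRoot_dotProduct_self hn i) v

theorem simpleReflection_inv (hn : 4 ≤ n) (i : Fin n) :
    (simpleReflection hn i)⁻¹ = simpleReflection hn i :=
  inv_eq_of_mul_eq_one_left (LinearEquiv.ext (simpleReflection_simpleReflection hn i))

theorem simpleReflection_mul_cancel_left (hn : 4 ≤ n) (i : Fin n)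
    (g : (Fin n → ℤ) ≃ₗ[ℤ] (Fin n → ℤ)) :
    simpleReflection hn i * (simpleReflection hn i * g) = g :=
  LinearEquiv.ext fun v => simpleReflection_simpleReflection hn i (g v)

/-- `α_i` is the only positive root that `s_i` makes negative. -/
theorem eq_simpleRoot_of_rho_simpleReflection_neg (hn : 4 ≤ n) {i : Fin n} {v : Fin n → ℤ}
    (hv : v ⬝ᵥ v = 2) (h0 : 0 < rho ⬝ᵥ v) (h1 : rho ⬝ᵥ simpleReflection hn i v < 0) :
    v = simpleRoot i := by
  by_contra h
  have h2 := dotProduct_le_one (simpleRoot_dotProduct_self hn i) hv (Ne.symm h)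
  rw [simpleReflection_apply, dotProduct_sub, dotProduct_smul, rho_simpleRoot hn, smul_eq_mul,
    mul_one] at h1
  omega

/-- An isometry that sends `α_i` to `α_j` conjugates `s_i` to `s_j`. -/
theorem simpleReflection_conj (hn : 4 ≤ n) {g : (Fin n → ℤ) ≃ₗ[ℤ] (Fin n → ℤ)}
    (hg : ∀ u v, g u ⬝ᵥ g v = u ⬝ᵥ v) {i j : Fin n} (h : g (simpleRoot i) = simpleRoot j) :
    simpleReflection hn j * g = g * simpleReflection hn i := by
  refine LinearEquiv.ext fun v => ?_
  rw [LinearEquiv.mul_apply, LinearEquiv.mul_apply, simpleReflection_apply, simpleReflection_apply,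
    map_sub, map_smul, ← h, hg]

theorem wordProd_nil (hn : 4 ≤ n) : wordProd hn [] = 1 := rfl

theorem wordProd_cons (hn : 4 ≤ n) (c : Fin n) (l : List (Fin n)) :
    wordProd hn (c :: l) = simpleReflection hn c * wordProd hn l := by
  simp [wordProd]

theorem wordProd_append (hn : 4 ≤ n) (l l' : List (Fin n)) :
    wordProd hn (l ++ l') = wordProd hn l * wordProd hn l' := by
  simp [wordProd]

theorem wordProd_dotProduct (hn : 4 ≤ n) (l : List (Fin n)) (u v : Fin n → ℤ) :
    wordProd hn l u ⬝ᵥ wordProd hn l v = u ⬝ᵥ v := by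
  induction l with
  | nil => rfl
  | cons c l ih =>
    rw [wordProd_cons, LinearEquiv.mul_apply, LinearEquiv.mul_apply, simpleReflection_dotProduct,
      ih]

theorem apply_inv_apply (g : (Fin n → ℤ) ≃ₗ[ℤ] (Fin n → ℤ)) (v : Fin n → ℤ) : g (g⁻¹ v) = v :=
  g.apply_symm_apply v

theorem inv_apply_apply (g : (Fin n → ℤ) ≃ₗ[ℤ] (Fin n → ℤ)) (v : Fin n → ℤ) : g⁻¹ (g v) = v :=
  g.symm_apply_apply v

theorem wordProd_inv_dotProduct (hn : 4 ≤ n) (l : List (Fin n)) (u v : Fin n → ℤ) :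
    (wordProd hn l)⁻¹ u ⬝ᵥ (wordProd hn l)⁻¹ v = u ⬝ᵥ v := by
  rw [← wordProd_dotProduct hn l, apply_inv_apply, apply_inv_apply]

theorem wordProd_cons_inv_apply (hn : 4 ≤ n) (c : Fin n) (l : List (Fin n)) (v : Fin n → ℤ) :
    (wordProd hn (c :: l))⁻¹ v = (wordProd hn l)⁻¹ (simpleReflection hn c v) := by
  rw [wordProd_cons, mul_inv_rev, LinearEquiv.mul_apply, simpleReflection_inv]

theorem wordProd_append_inv_apply (hn : 4 ≤ n) (l l' : List (Fin n)) (v : Fin n → ℤ) :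
    (wordProd hn (l ++ l'))⁻¹ v = (wordProd hn l')⁻¹ ((wordProd hn l)⁻¹ v) := by
  rw [wordProd_append, mul_inv_rev, LinearEquiv.mul_apply]

theorem wordProd_apply_of_orthogonal (hn : 4 ≤ n) {l : List (Fin n)} {v : Fin n → ℤ}
    (h : ∀ c ∈ l, simpleRoot c ⬝ᵥ v = 0) : wordProd hn l v = v := by
  induction l with
  | nil => rfl
  | cons c l ih =>
    rw [wordProd_cons, LinearEquiv.mul_apply, ih fun d hd => h d (List.mem_cons_of_mem _ hd),
      simpleReflection_of_orthogonal hn (h c List.mem_cons_self)]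

/-- If the letters at positions inside `P` commute with all earlier letters at positions
outside `P`, then the letters inside `P` can be moved to the front. -/
theorem wordProd_filter_mul_wordProd_filter (hn : 4 ≤ n) {ι : Type*} (f : ι → Fin n) (P : ι → Prop)
    [DecidablePred P] {l : List ι}
    (h : l.Pairwise fun i j => ¬ P i → P j → simpleRoot (f i) ⬝ᵥ simpleRoot (f j) = 0) :
    wordProd hn ((l.filter fun i => P i).map f) * wordProd hn ((l.filter fun i => ¬ P i).map f) =
      wordProd hn (l.map f) := by
  induction l with
  | nil => simp [wordProd_nil]
  | cons i l ih =>
    rw [List.pairwise_cons] at h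
    by_cases hi : P i
    · simp only [hi, decide_true, List.filter_cons_of_pos, not_true, decide_false,
        Bool.false_eq_true, not_false_eq_true, List.filter_cons_of_neg, List.map_cons,
        wordProd_cons, mul_assoc, ih h.2]
    · simp only [hi, decide_true, List.filter_cons_of_pos, decide_false,
        Bool.false_eq_true, not_false_eq_true, List.filter_cons_of_neg, List.map_cons,
        wordProd_cons, ← ih h.2]
      have hcomm : ∀ l' : List (Fin n), (∀ c ∈ l', simpleRoot (f i) ⬝ᵥ simpleRoot c = 0) →
          wordProd hn l' * simpleReflection hn (f i) =
            simpleReflection hn (f i) * wordProd hn l' := by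
        intro l' hl'
        exact (simpleReflection_conj hn (wordProd_dotProduct hn l')
          (wordProd_apply_of_orthogonal hn fun c hc => by
            rw [dotProduct_comm]; exact hl' c hc)).symm
      rw [← mul_assoc, hcomm, mul_assoc]
      intro c hc
      obtain ⟨j, hj, rfl⟩ := List.mem_map.1 hc
      rw [List.mem_filter] at hj
      exact h.1 j hj.1 hi (by simpa using hj.2)

/-! ### Reduced words and inversions -/

/-- A positive root that the inverse of a word makes negative is the root at which one of the
letters of the word changes the sign. -/
theorem exists_split_of_rho_inv_neg (hn : 4 ≤ n) {l : List (Fin n)} {v : Fin n → ℤ}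
    (hv : v ⬝ᵥ v = 2) (h0 : 0 < rho ⬝ᵥ v) (h1 : rho ⬝ᵥ (wordProd hn l)⁻¹ v < 0) :
    ∃ p c s, l = p ++ c :: s ∧ v = wordProd hn p (simpleRoot c) := by
  induction l generalizing v with
  | nil => exact absurd h1 h0.not_gt
  | cons c l ih =>
    rw [wordProd_cons_inv_apply] at h1
    have hv' : simpleReflection hn c v ⬝ᵥ simpleReflection hn c v = 2 := by
      rw [simpleReflection_dotProduct, hv]
    rcases lt_or_gt_of_ne (rho_ne_zero hv') with h | h
    · exact ⟨[], c, l, rfl, eq_simpleRoot_of_rho_simpleReflection_neg hn hv h0 h⟩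
    · obtain ⟨p, d, s, rfl, hp⟩ := ih hv' h h1
      refine ⟨c :: p, d, s, rfl, ?_⟩
      rw [wordProd_cons, LinearEquiv.mul_apply, ← hp, simpleReflection_simpleReflection]

/-- Every letter of a reduced word contributes an inversion: the root obtained from it by the
inverse of the letters to its right is positive. -/
theorem IsReducedWord.rho_suffix_pos (hn : 4 ≤ n) {w : (Fin n → ℤ) ≃ₗ[ℤ] (Fin n → ℤ)}
    {p s : List (Fin n)} {c : Fin n} (h : IsReducedWord hn (p ++ c :: s) w) :
    0 < rho ⬝ᵥ (wordProd hn s)⁻¹ (simpleRoot c) := by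
  have hc := simpleRoot_dotProduct_self hn c
  by_contra hneg
  have hne : rho ⬝ᵥ (wordProd hn s)⁻¹ (simpleRoot c) ≠ 0 :=
    rho_ne_zero (by rw [wordProd_inv_dotProduct, hc])
  obtain ⟨q, d, s', rfl, hq⟩ := exists_split_of_rho_inv_neg hn hc
    (by rw [rho_simpleRoot hn]; norm_num) (lt_of_le_of_ne (not_lt.1 hneg) hne)
  have hconj := simpleReflection_conj hn (wordProd_dotProduct hn q) hq.symm
  -- The letters `c` and `d` can be cancelled, so the word is not reduced.
  have h1 := h.2 (p ++ (q ++ s')) (by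
    rw [← h.1]
    simp only [wordProd_append, wordProd_cons]
    rw [← mul_assoc (simpleReflection hn c), hconj, mul_assoc, simpleReflection_mul_cancel_left])
  simp only [List.length_append, List.length_cons] at h1
  omega

theorem IsReducedWord.rho_prefix_pos (hn : 4 ≤ n) {w : (Fin n → ℤ) ≃ₗ[ℤ] (Fin n → ℤ)}
    {p s : List (Fin n)} {c : Fin n} (h : IsReducedWord hn (p ++ c :: s) w) :
    0 < rho ⬝ᵥ wordProd hn p (simpleRoot c) := by
  have hc := simpleRoot_dotProduct_self hn c
  by_contra hneg
  have hv : wordProd hn p (simpleRoot c) ⬝ᵥ wordProd hn p (simpleRoot c) = 2 := by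
    rw [wordProd_dotProduct, hc]
  have hne := rho_ne_zero hv
  obtain ⟨q, d, s', rfl, hq⟩ := exists_split_of_rho_inv_neg hn (l := p)
    (v := -wordProd hn p (simpleRoot c)) (by simpa using hv) (by rw [dotProduct_neg]; omega)
    (by rw [map_neg, inv_apply_apply, dotProduct_neg, rho_simpleRoot hn]; norm_num)
  rw [wordProd_append, wordProd_cons, LinearEquiv.mul_apply, LinearEquiv.mul_apply, ← map_neg] at hq
  have hq := (wordProd hn q).injective hq
  have hs : wordProd hn s' (simpleRoot c) = simpleRoot d := by
    rw [← simpleReflection_simpleReflection hn d (wordProd hn s' (simpleRoot c)),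
      neg_eq_iff_eq_neg.1 hq, map_neg, simpleReflection_simpleRoot, neg_neg]
  have hconj := simpleReflection_conj hn (wordProd_dotProduct hn s') hs
  have h1 := h.2 (q ++ (s' ++ s)) (by
    rw [← h.1]
    simp only [wordProd_append, wordProd_cons]
    rw [hconj, mul_assoc, mul_assoc, simpleReflection_mul_cancel_left])
  simp only [List.length_append, List.length_cons] at h1
  omega

/-- For a prefix `x` of a reduced word of `w`, the inversions of `x⁻¹` are inversions of `w⁻¹`. -/
theorem IsReducedWord.rho_inv_neg_of_prefix (hn : 4 ≤ n) {w : (Fin n → ℤ) ≃ₗ[ℤ] (Fin n → ℤ)}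
    {l l' : List (Fin n)} (h : IsReducedWord hn (l ++ l') w) {v : Fin n → ℤ} (hv : v ⬝ᵥ v = 2)
    (h0 : 0 < rho ⬝ᵥ v) (h1 : rho ⬝ᵥ (wordProd hn l)⁻¹ v < 0) : rho ⬝ᵥ w⁻¹ v < 0 := by
  obtain ⟨p, c, s, rfl, rfl⟩ := exists_split_of_rho_inv_neg hn hv h0 h1
  rw [List.append_assoc, List.cons_append] at h
  rw [← h.1, wordProd_append_inv_apply, inv_apply_apply, wordProd_cons_inv_apply,
    simpleReflection_simpleRoot, map_neg, dotProduct_neg, neg_neg_iff_pos]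
  exact h.rho_suffix_pos hn

/-- For a suffix `u` of a reduced word of `w`, the inversions of `u` are inversions of `w`. -/
theorem IsReducedWord.rho_neg_of_suffix (hn : 4 ≤ n) {w : (Fin n → ℤ) ≃ₗ[ℤ] (Fin n → ℤ)}
    {l l' : List (Fin n)} (h : IsReducedWord hn (l ++ l') w) {v : Fin n → ℤ} (hv : v ⬝ᵥ v = 2)
    (h0 : 0 < rho ⬝ᵥ v) (h1 : rho ⬝ᵥ wordProd hn l' v < 0) : rho ⬝ᵥ w v < 0 := by
  have hw : w v = wordProd hn l (wordProd hn l' v) := by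
    rw [← h.1, wordProd_append, LinearEquiv.mul_apply]
  have hwv : w v ⬝ᵥ w v = 2 := by rw [← h.1, wordProd_dotProduct, hv]
  refine (lt_or_gt_of_ne (rho_ne_zero hwv)).resolve_right fun h2 => ?_
  have h3 := h.rho_inv_neg_of_prefix hn hwv h2 (by rwa [hw, inv_apply_apply])
  rw [inv_apply_apply] at h3
  exact h3.not_gt h0

/-- In a reduced word, two equal letters are separated by a letter not orthogonal to them. -/
theorem IsReducedWord.exists_nonorthogonal (hn : 4 ≤ n) {w : (Fin n → ℤ) ≃ₗ[ℤ] (Fin n → ℤ)}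
    {p m s : List (Fin n)} {c : Fin n} (h : IsReducedWord hn (p ++ c :: (m ++ c :: s)) w) :
    ∃ d ∈ m, simpleRoot d ⬝ᵥ simpleRoot c ≠ 0 := by
  by_contra! hm
  have h1 := h.rho_suffix_pos hn
  have h2 : wordProd hn m (simpleRoot c) = simpleRoot c := wordProd_apply_of_orthogonal hn hm
  rw [wordProd_append_inv_apply, show (wordProd hn m)⁻¹ (simpleRoot c) = simpleRoot c by
      nth_rw 1 [← h2]; exact inv_apply_apply _ _, wordProd_cons_inv_apply,
    simpleReflection_simpleRoot, map_neg, dotProduct_neg] at h1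
  rw [← List.cons_append, ← List.append_assoc] at h
  have h3 := h.rho_suffix_pos hn
  omega

/-! ### Inversions of a minuscule element -/

/-- `w` maps every simple root other than `α_r` to a vector of positive height: `w` is the minimal
representative of its coset modulo the stabiliser of the fundamental weight of `r`. -/
def IsMinimalRepresentative (w : (Fin n → ℤ) ≃ₗ[ℤ] (Fin n → ℤ)) (r : Fin n) : Prop :=
  ∀ i, i ≠ r → 0 < rho ⬝ᵥ w (simpleRoot i)

theorem dotProduct_sum_simpleRoot (u : Fin n → ℤ) (c : Fin n → ℕ) :
    u ⬝ᵥ ∑ i, c i • simpleRoot i = ∑ i, (c i : ℤ) * (u ⬝ᵥ simpleRoot i) := by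
  rw [dotProduct_sum]
  exact Finset.sum_congr rfl fun i _ => by rw [dotProduct_smul, nsmul_eq_mul]

theorem eq_zero_of_sum_simpleRoot_eq_zero (hn : 4 ≤ n) {c : Fin n → ℕ}
    (h : ∑ i, c i • simpleRoot i = 0) : c = 0 := by
  have h1 := dotProduct_sum_simpleRoot rho c
  rw [h, dotProduct_zero] at h1
  simp only [rho_simpleRoot hn, mul_one] at h1
  have h2 := (Finset.sum_eq_zero_iff_of_nonneg fun i _ => by positivity).1 h1.symm
  exact funext fun i => by simpa using h2 i (Finset.mem_univ i)

theorem rho_apply_sum_simpleRoot (w : (Fin n → ℤ) ≃ₗ[ℤ] (Fin n → ℤ)) (c : Fin n → ℕ) :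
    rho ⬝ᵥ w (∑ i, c i • simpleRoot i) = ∑ i, (c i : ℤ) * (rho ⬝ᵥ w (simpleRoot i)) := by
  rw [map_sum, dotProduct_sum]
  exact Finset.sum_congr rfl fun i _ => by rw [map_nsmul, dotProduct_smul, nsmul_eq_mul]

theorem IsDoubledMinusculeWeight.dotProduct_sum {ϖ : Fin n → ℤ} {r : Fin n}
    (hϖ : IsDoubledMinusculeWeight ϖ r) (c : Fin n → ℕ) :
    ϖ ⬝ᵥ ∑ i, c i • simpleRoot i = 2 * c r := by
  rw [dotProduct_sum_simpleRoot, Finset.sum_eq_single r, hϖ.dotProduct_self, mul_comm]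
  · intro i _ hi
    rw [hϖ.dotProduct_of_ne i hi, mul_zero]
  · simp

theorem IsDoubledMinusculeWeight.dotProduct_nonneg (hn : 4 ≤ n) {ϖ : Fin n → ℤ} {r : Fin n}
    (hϖ : IsDoubledMinusculeWeight ϖ r) {v : Fin n → ℤ} (hv : v ⬝ᵥ v = 2) (h0 : 0 < rho ⬝ᵥ v) :
    0 ≤ ϖ ⬝ᵥ v := by
  obtain ⟨c, rfl⟩ := ((isPositiveRoot_iff hv).2 h0).exists_eq_sum hn
  rw [hϖ.dotProduct_sum]
  positivity

theorem IsMinimalRepresentative.rho_sum_nonneg {w : (Fin n → ℤ) ≃ₗ[ℤ] (Fin n → ℤ)} {r : Fin n}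
    (hw : IsMinimalRepresentative w r) {c : Fin n → ℕ} (hc : c r = 0) :
    0 ≤ rho ⬝ᵥ w (∑ i, c i • simpleRoot i) := by
  rw [rho_apply_sum_simpleRoot]
  refine Finset.sum_nonneg fun i _ => ?_
  by_cases hi : i = r
  · simp [hi, hc]
  · have := hw i hi
    positivity

theorem IsMinimalRepresentative.eq_zero_of_rho_sum_eq_zero
    {w : (Fin n → ℤ) ≃ₗ[ℤ] (Fin n → ℤ)} {r : Fin n} (hw : IsMinimalRepresentative w r)
    {c : Fin n → ℕ} (hc : c r = 0) (h : rho ⬝ᵥ w (∑ i, c i • simpleRoot i) = 0) : c = 0 := by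
  rw [rho_apply_sum_simpleRoot] at h
  rw [Finset.sum_eq_zero_iff_of_nonneg] at h
  · funext i
    by_cases hi : i = r
    · rw [hi, hc]; rfl
    · have h1 := h i (Finset.mem_univ i)
      have h2 := hw i hi
      simpa [h2.ne'] using h1
  · intro i _
    by_cases hi : i = r
    · simp [hi, hc]
    · have := hw i hi
      positivity

/-- Every inversion of `w` has `α_r`-coefficient `1`. -/
theorem IsMinimalRepresentative.weight_eq_two (hn : 4 ≤ n) {w : (Fin n → ℤ) ≃ₗ[ℤ] (Fin n → ℤ)}
    {r : Fin n} (hw : IsMinimalRepresentative w r) {ϖ : Fin n → ℤ}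
    (hϖ : IsDoubledMinusculeWeight ϖ r) {v : Fin n → ℤ} (hv : v ⬝ᵥ v = 2) (h0 : 0 < rho ⬝ᵥ v)
    (h1 : rho ⬝ᵥ w v < 0) : ϖ ⬝ᵥ v = 2 := by
  have h2 := hϖ.dotProduct_le v hv
  obtain ⟨c, rfl⟩ := ((isPositiveRoot_iff hv).2 h0).exists_eq_sum hn
  rw [hϖ.dotProduct_sum] at h2 ⊢
  have : c r ≠ 0 := fun h => (hw.rho_sum_nonneg h).not_gt h1
  omega

/-- Two inversions of `w` never have negative inner product, since their sum would be a root
with `α_r`-coefficient `2`. -/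
theorem IsMinimalRepresentative.dotProduct_nonneg (hn : 4 ≤ n)
    {w : (Fin n → ℤ) ≃ₗ[ℤ] (Fin n → ℤ)} {r : Fin n} (hw : IsMinimalRepresentative w r)
    {ϖ : Fin n → ℤ} (hϖ : IsDoubledMinusculeWeight ϖ r) {u v : Fin n → ℤ}
    (hu : u ⬝ᵥ u = 2) (hu0 : 0 < rho ⬝ᵥ u) (hu1 : rho ⬝ᵥ w u < 0)
    (hv : v ⬝ᵥ v = 2) (hv0 : 0 < rho ⬝ᵥ v) (hv1 : rho ⬝ᵥ w v < 0) : 0 ≤ u ⬝ᵥ v := by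
  by_contra! h
  have h1 : -u ⬝ᵥ v ≤ 1 := by
    refine dotProduct_le_one (by simpa using hu) hv ?_
    rintro rfl
    rw [dotProduct_neg] at hv0
    omega
  rw [neg_dotProduct] at h1
  have h2 := hϖ.dotProduct_le (u + v) (by
    rw [add_dotProduct, dotProduct_add, dotProduct_add, dotProduct_comm v u, hu, hv]
    omega)
  rw [dotProduct_add, hw.weight_eq_two hn hϖ hu hu0 hu1, hw.weight_eq_two hn hϖ hv hv0 hv1] at h2
  omega

/-- The inversions of `w⁻¹` inherit the same property, as `-w⁻¹` maps them to those of `w`. -/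
theorem IsMinimalRepresentative.inv_dotProduct_nonneg (hn : 4 ≤ n)
    {w : (Fin n → ℤ) ≃ₗ[ℤ] (Fin n → ℤ)} {r : Fin n} (hw : IsMinimalRepresentative w r)
    (hiso : ∀ u v, w⁻¹ u ⬝ᵥ w⁻¹ v = u ⬝ᵥ v)
    {ϖ : Fin n → ℤ} (hϖ : IsDoubledMinusculeWeight ϖ r) {u v : Fin n → ℤ}
    (hu : u ⬝ᵥ u = 2) (hu0 : 0 < rho ⬝ᵥ u) (hu1 : rho ⬝ᵥ w⁻¹ u < 0)
    (hv : v ⬝ᵥ v = 2) (hv0 : 0 < rho ⬝ᵥ v) (hv1 : rho ⬝ᵥ w⁻¹ v < 0) : 0 ≤ u ⬝ᵥ v := by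
  have := hw.dotProduct_nonneg hn hϖ (u := -w⁻¹ u) (v := -w⁻¹ v)
    (by rw [neg_dotProduct_neg, hiso, hu]) (by rw [dotProduct_neg]; omega)
    (by rw [map_neg, apply_inv_apply, dotProduct_neg]; omega)
    (by rw [neg_dotProduct_neg, hiso, hv]) (by rw [dotProduct_neg]; omega)
    (by rw [map_neg, apply_inv_apply, dotProduct_neg]; omega)
  rwa [neg_dotProduct_neg, hiso] at this

theorem _root_.List.exists_last_split {α : Type*} {P : α → Prop} {l : List α}
    (h : ∃ a ∈ l, P a) : ∃ p a s, l = p ++ a :: s ∧ P a ∧ ∀ b ∈ s, ¬ P b := by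
  induction l with
  | nil => simp at h
  | cons c l ih =>
    by_cases hl : ∃ a ∈ l, P a
    · obtain ⟨p, a, s, rfl, ha, hs⟩ := ih hl
      exact ⟨c :: p, a, s, rfl, ha, hs⟩
    · push Not at hl
      obtain ⟨a, ha, hPa⟩ := h
      rcases List.mem_cons.1 ha with rfl | ha
      · exact ⟨[], a, l, rfl, hPa, hl⟩
      · exact absurd hPa (hl a ha)

/-- A left descent of a prefix of a reduced word of a minuscule element is a letter of that prefix
which is orthogonal to all earlier ones. -/
theorem IsReducedWord.exists_split_of_descent (hn : 4 ≤ n)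
    {w : (Fin n → ℤ) ≃ₗ[ℤ] (Fin n → ℤ)} {r : Fin n} (hw : IsMinimalRepresentative w r)
    {ϖ : Fin n → ℤ} (hϖ : IsDoubledMinusculeWeight ϖ r) {l l' : List (Fin n)}
    (h : IsReducedWord hn (l ++ l') w) {b : Fin n}
    (hb : rho ⬝ᵥ (wordProd hn l)⁻¹ (simpleRoot b) < 0) :
    ∃ p s, l = p ++ b :: s ∧ ∀ d ∈ p, simpleRoot d ⬝ᵥ simpleRoot b = 0 := by
  have hb2 := simpleRoot_dotProduct_self hn b
  have hb0 : 0 < rho ⬝ᵥ simpleRoot b := by rw [rho_simpleRoot hn]; norm_num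
  obtain ⟨p, c, s, rfl, hp⟩ := exists_split_of_rho_inv_neg hn hb2 hb0 hb
  suffices hcomm : ∀ d ∈ p, simpleRoot d ⬝ᵥ simpleRoot c = 0 by
    rw [wordProd_apply_of_orthogonal hn hcomm] at hp
    obtain rfl := simpleRoot_injective hn hp
    exact ⟨p, s, rfl, hcomm⟩
  by_contra! hne
  obtain ⟨p, d, q, rfl, hd, hq⟩ := List.exists_last_split hne
  simp only [not_not] at hq
  have h' : IsReducedWord hn (p ++ d :: (q ++ c :: (s ++ l'))) w := by simpa using h
  have hpos := h'.rho_prefix_pos hn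
  rw [wordProd_append, wordProd_cons, LinearEquiv.mul_apply, LinearEquiv.mul_apply,
    wordProd_apply_of_orthogonal hn hq] at hp
  by_cases hdc : d = c
  · rw [hdc, simpleReflection_simpleRoot, map_neg] at hp
    rw [hp, dotProduct_neg, ← hdc] at hb0
    omega
  have hdc1 := simpleRoot_dotProduct_eq_neg_one hn hdc hd
  -- The root `α_b` is the sum of the roots `x α_d > 0` and `κ = x α_c`; as `α_b` has height one,
  -- `-κ` is positive, hence an inversion, but its inner product with `α_b` is `-1`.
  rw [simpleReflection_apply, hdc1, neg_smul, one_smul, sub_neg_eq_add, map_add] at hp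
  set κ := wordProd hn p (simpleRoot c) with hκ
  have hκ2 : κ ⬝ᵥ κ = 2 := by rw [hκ, wordProd_dotProduct, simpleRoot_dotProduct_self]; exact hn
  have hκ0 : rho ⬝ᵥ κ < 0 := by
    have h1 := congrArg (rho ⬝ᵥ ·) hp
    simp only [dotProduct_add, rho_simpleRoot hn] at h1
    have := rho_ne_zero hκ2
    omega
  have hbκ : simpleRoot b ⬝ᵥ κ = 1 := by
    rw [hp, add_dotProduct, hκ2, hκ, wordProd_dotProduct, hdc1]
    norm_num
  have hinv : rho ⬝ᵥ w⁻¹ (-κ) < 0 := by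
    refine h'.rho_inv_neg_of_prefix hn (by simpa using hκ2) (by rw [dotProduct_neg]; omega) ?_
    rw [map_neg, hκ, inv_apply_apply, dotProduct_neg, rho_simpleRoot hn]
    norm_num
  have := hw.inv_dotProduct_nonneg hn (by intro u v; rw [← h.1, wordProd_inv_dotProduct]) hϖ hb2 hb0
    (h.rho_inv_neg_of_prefix hn hb2 hb0 hb) (by simpa using hκ2)
    (by rw [dotProduct_neg]; omega) hinv
  rw [dotProduct_neg, hbκ] at this
  omega

/-! ### Comparison of the two roots -/

/-- A vector that pairs nonpositively with each letter at the moment its reflection is applied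
grows by a nonnegative combination of simple roots, and is fixed only if it is orthogonal to all
letters. -/
theorem exists_inv_apply_eq_add_sum (hn : 4 ≤ n) {l : List (Fin n)} {v : Fin n → ℤ}
    (h : ∀ p c s, l = p ++ c :: s → simpleRoot c ⬝ᵥ (wordProd hn p)⁻¹ v ≤ 0) :
    ∃ k : Fin n → ℕ, (wordProd hn l)⁻¹ v = v + ∑ i, k i • simpleRoot i ∧
      (k = 0 → ∀ c ∈ l, simpleRoot c ⬝ᵥ v = 0) := by
  induction l generalizing v with
  | nil => exact ⟨0, by simp [wordProd_nil], by simp⟩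
  | cons c l ih =>
    have hc : simpleRoot c ⬝ᵥ v ≤ 0 := h [] c l rfl
    obtain ⟨m, hm⟩ := Int.eq_ofNat_of_zero_le (neg_nonneg.2 hc)
    have hrefl : simpleReflection hn c v = v + m • simpleRoot c := by
      rw [simpleReflection_apply, sub_eq_add_neg, ← neg_smul, hm, natCast_zsmul]
    obtain ⟨k, hk, hk0⟩ := ih (v := simpleReflection hn c v) fun p d s hl => by
      have := h (c :: p) d s (by rw [hl, List.cons_append])
      rwa [wordProd_cons_inv_apply] at this
    refine ⟨Pi.single c m + k, ?_, fun h0 => ?_⟩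
    · rw [wordProd_cons_inv_apply, hk, hrefl]
      simp [add_smul, Finset.sum_add_distrib, Pi.single_apply, ite_smul, add_assoc]
    · have hm0 : m = 0 := by
        have := congrFun h0 c
        simp at this
        exact this.1
      have hv : simpleReflection hn c v = v := by rw [hrefl, hm0, zero_smul, add_zero]
      rw [hv] at hk0
      rw [hm0] at hm h0
      simp only [Pi.single_zero, zero_add] at h0
      intro d hd
      rcases List.mem_cons.1 hd with rfl | hd
      · simpa using hm
      · exact hk0 h0 d hd

/-- The root `γ` attached to a left descent of a prefix of a reduced word grows to the
corresponding root of the whole word by adding simple roots, because each letter `c` of the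
remaining word contributes minus the inner product of two inversions. -/
theorem IsReducedWord.exists_inv_eq_sub_sum (hn : 4 ≤ n)
    {w : (Fin n → ℤ) ≃ₗ[ℤ] (Fin n → ℤ)} {r : Fin n} (hw : IsMinimalRepresentative w r)
    {ϖ : Fin n → ℤ} (hϖ : IsDoubledMinusculeWeight ϖ r) {l l' : List (Fin n)}
    (h : IsReducedWord hn (l ++ l') w) {a : Fin n}
    (ha : rho ⬝ᵥ (wordProd hn l)⁻¹ (simpleRoot a) < 0) :
    ∃ k : Fin n → ℕ, w⁻¹ (simpleRoot a) =
        (wordProd hn l)⁻¹ (simpleRoot a) - ∑ i, k i • simpleRoot i ∧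
      (k = 0 → ∀ c ∈ l', simpleRoot c ⬝ᵥ (wordProd hn l)⁻¹ (simpleRoot a) = 0) := by
  have ha2 := simpleRoot_dotProduct_self hn a
  have ha0 : 0 < rho ⬝ᵥ simpleRoot a := by rw [rho_simpleRoot hn]; norm_num
  have hwa := h.rho_inv_neg_of_prefix hn ha2 ha0 ha
  have hiso : ∀ u v, w⁻¹ u ⬝ᵥ w⁻¹ v = u ⬝ᵥ v := by
    intro u v; rw [← h.1, wordProd_inv_dotProduct]
  obtain ⟨k, hk, hk0⟩ := exists_inv_apply_eq_add_sum hn (l := l')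
    (v := -(wordProd hn l)⁻¹ (simpleRoot a)) (by
      rintro p c s rfl
      have hsuf := IsReducedWord.rho_suffix_pos hn (p := l ++ p) (s := s) (c := c) (w := w)
        (by simpa using h)
      have hpre := IsReducedWord.rho_prefix_pos hn (p := l ++ p) (s := s) (c := c) (w := w)
        (by simpa using h)
      have hinv : w⁻¹ (wordProd hn (l ++ p) (simpleRoot c)) =
          -(wordProd hn s)⁻¹ (simpleRoot c) := by
        rw [← h.1, ← List.append_assoc, wordProd_append_inv_apply hn (l ++ p), inv_apply_apply,
          wordProd_cons_inv_apply, simpleReflection_simpleRoot, map_neg]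
      have := hw.inv_dotProduct_nonneg hn hiso hϖ (u := wordProd hn (l ++ p) (simpleRoot c))
        (by rw [wordProd_dotProduct, simpleRoot_dotProduct_self hn]) hpre
        (by rw [hinv, dotProduct_neg]; omega) ha2 ha0 hwa
      rw [map_neg, dotProduct_neg, ← wordProd_append_inv_apply, neg_nonpos]
      rwa [← wordProd_inv_dotProduct hn (l ++ p), inv_apply_apply] at this)
  refine ⟨k, ?_, fun h0 c hc => ?_⟩
  · rw [← h.1, wordProd_append_inv_apply, ← neg_inj, ← map_neg, hk]
    abel
  · simpa using hk0 h0 c hc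

theorem even_dotProduct_sum_simpleRoot (c : Fin n → ℕ) :
    Even ((∑ i, c i • simpleRoot i) ⬝ᵥ (∑ i, c i • simpleRoot i) : ℤ) := by
  have h1 : ∀ v : Fin n → ℤ, Even (v ⬝ᵥ v + (fun _ => 1) ⬝ᵥ v) := by
    intro v
    rw [← add_dotProduct]
    refine Finset.even_sum _ fun i _ => ?_
    have := Int.even_mul_succ_self (v i)
    simpa [mul_comm] using this
  have h2 : Even ((fun _ => 1) ⬝ᵥ ∑ i, c i • simpleRoot i : ℤ) := by
    rw [dotProduct_sum_simpleRoot]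
    refine Finset.even_sum _ fun i _ => Even.mul_left ?_ _
    unfold simpleRoot
    split_ifs <;> simp [dotProduct_sub, dotProduct_add]
  exact (Int.even_add.1 (h1 _)).2 h2

theorem sum_tsub_sub_sum_tsub (c d : Fin n → ℕ) :
    ∑ i, (c - d) i • simpleRoot i - ∑ i, (d - c) i • simpleRoot i =
      ∑ i, c i • simpleRoot i - ∑ i, d i • simpleRoot i := by
  rw [← Finset.sum_sub_distrib, ← Finset.sum_sub_distrib]
  refine Finset.sum_congr rfl fun i _ => ?_
  rcases le_total (c i) (d i) with h | h
  · obtain ⟨e, he⟩ := Nat.exists_eq_add_of_le h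
    simp [he, add_smul]
  · obtain ⟨e, he⟩ := Nat.exists_eq_add_of_le h
    simp [he, add_smul]

/-- Two orthogonal roots, neither of which dominates the other: if `v - v' = X - Y` in terms of
disjoint nonnegative combinations of simple roots, then `X` and `Y` are roots. -/
theorem dotProduct_self_sum_tsub (hn : 4 ≤ n) {c d : Fin n → ℕ}
    (hc : (∑ i, c i • simpleRoot i) ⬝ᵥ (∑ i, c i • simpleRoot i) = 2)
    (hd : (∑ i, d i • simpleRoot i) ⬝ᵥ (∑ i, d i • simpleRoot i) = 2)
    (hcd : (∑ i, c i • simpleRoot i) ⬝ᵥ (∑ i, d i • simpleRoot i) = 0)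
    (hX : c - d ≠ 0) (hY : d - c ≠ 0) :
    (∑ i, (c - d) i • simpleRoot i) ⬝ᵥ (∑ i, (c - d) i • simpleRoot i) = 2 ∧
    (∑ i, (d - c) i • simpleRoot i) ⬝ᵥ (∑ i, (d - c) i • simpleRoot i) = 2 := by
  have hpos : ∀ e : Fin n → ℕ, e ≠ 0 →
      2 ≤ (∑ i, e i • simpleRoot i) ⬝ᵥ (∑ i, e i • simpleRoot i) := by
    intro e he
    obtain ⟨m, hm⟩ := even_dotProduct_sum_simpleRoot e
    have h1 := dotProduct_self_nonneg (∑ i, e i • simpleRoot i)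
    by_contra! h2
    exact he (eq_zero_of_sum_simpleRoot_eq_zero hn (dotProduct_self_eq_zero.1 (by omega)))
  have hXY : (∑ i, (c - d) i • simpleRoot i) ⬝ᵥ (∑ i, (d - c) i • simpleRoot i) ≤ 0 := by
    rw [dotProduct_sum_simpleRoot]
    refine Finset.sum_nonpos fun j _ => ?_
    rw [dotProduct_comm, dotProduct_sum_simpleRoot, Finset.mul_sum]
    refine Finset.sum_nonpos fun i _ => ?_
    by_cases hij : j = i
    · subst hij
      rcases le_total (c j) (d j) with h | h <;> simp [Nat.sub_eq_zero_of_le h]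
    · have := simpleRoot_dotProduct_nonpos hn hij
      exact mul_nonpos_of_nonneg_of_nonpos (by positivity)
        (mul_nonpos_of_nonneg_of_nonpos (by positivity) this)
  have hnorm := congrArg (fun v => v ⬝ᵥ v) (sum_tsub_sub_sum_tsub c d)
  simp only [sub_dotProduct, dotProduct_sub] at hnorm
  rw [hc, hd, hcd, dotProduct_comm (∑ i, d i • simpleRoot i), hcd,
    dotProduct_comm (∑ i, (d - c) i • simpleRoot i) (∑ i, (c - d) i • simpleRoot i)] at hnorm
  have h1 := hpos _ hX
  have h2 := hpos _ hY
  omega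

/-- The root `γ` of a left descent of a prefix cannot be orthogonal to all letters of the
remaining word, if that word is nonempty and its first letter commutes with the prefix. Otherwise
`γ` and the inversion `δ'` of that first letter are orthogonal inversions, and their meet in the
root order is an inversion of the remaining word that is not orthogonal to `γ`. -/
theorem IsReducedWord.not_orthogonal (hn : 4 ≤ n)
    {w : (Fin n → ℤ) ≃ₗ[ℤ] (Fin n → ℤ)} {r : Fin n} (hw : IsMinimalRepresentative w r)
    {ϖ : Fin n → ℤ} (hϖ : IsDoubledMinusculeWeight ϖ r) {l l' : List (Fin n)} {a b : Fin n}
    (h : IsReducedWord hn (l ++ b :: l') w)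
    (ha : rho ⬝ᵥ (wordProd hn l)⁻¹ (simpleRoot a) < 0)
    (hb : ∀ c ∈ l, simpleRoot c ⬝ᵥ simpleRoot b = 0) :
    ¬ ∀ c ∈ b :: l', simpleRoot c ⬝ᵥ (wordProd hn l)⁻¹ (simpleRoot a) = 0 := by
  intro horth
  have ha2 := simpleRoot_dotProduct_self hn a
  have hb2 := simpleRoot_dotProduct_self hn b
  have hwu : ∀ v, w v = wordProd hn l (wordProd hn (b :: l') v) := fun v => by
    rw [← h.1, wordProd_append, LinearEquiv.mul_apply]
  set u := wordProd hn (b :: l') with hu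
  have hu_iso : ∀ x y, u x ⬝ᵥ u y = x ⬝ᵥ y := wordProd_dotProduct hn _
  set γ := -(wordProd hn l)⁻¹ (simpleRoot a) with hγ
  have horth' : ∀ c ∈ b :: l', simpleRoot c ⬝ᵥ γ = 0 := fun c hc => by
    rw [hγ, dotProduct_neg, horth c hc, neg_zero]
  have huγ : u γ = γ := wordProd_apply_of_orthogonal hn horth'
  have hγ2 : γ ⬝ᵥ γ = 2 := by rw [hγ, neg_dotProduct_neg, wordProd_inv_dotProduct, ha2]
  have hγ0 : 0 < rho ⬝ᵥ γ := by rw [hγ, dotProduct_neg]; omega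
  have hwγ : w γ = -simpleRoot a := by rw [hwu, huγ, hγ, map_neg, apply_inv_apply]
  have hγϖ : ϖ ⬝ᵥ γ = 2 := hw.weight_eq_two hn hϖ hγ2 hγ0 (by
    rw [hwγ, dotProduct_neg, rho_simpleRoot hn]; norm_num)
  set δ := -u⁻¹ (simpleRoot b) with hδ
  have huδ : u δ = -simpleRoot b := by rw [hδ, map_neg, apply_inv_apply]
  have hδ2 : δ ⬝ᵥ δ = 2 := by
    rw [hδ, neg_dotProduct_neg, hu, wordProd_inv_dotProduct, hb2]
  have hδ0 : 0 < rho ⬝ᵥ δ := by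
    rw [hδ, hu, wordProd_cons_inv_apply, simpleReflection_simpleRoot, map_neg, neg_neg]
    exact h.rho_suffix_pos hn
  have hwδ : w δ = -simpleRoot b := by
    rw [hwu, huδ, map_neg, wordProd_apply_of_orthogonal hn hb]
  have hδϖ : ϖ ⬝ᵥ δ = 2 := hw.weight_eq_two hn hϖ hδ2 hδ0 (by
    rw [hwδ, dotProduct_neg, rho_simpleRoot hn]; norm_num)
  have hγδ : γ ⬝ᵥ δ = 0 := by
    rw [← hu_iso, huγ, huδ, dotProduct_neg, dotProduct_comm, horth' b List.mem_cons_self, neg_zero]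
  -- Write `γ - δ = X - Y` with `X` and `Y` disjoint combinations of simple roots.
  obtain ⟨c, hc⟩ := ((isPositiveRoot_iff hγ2).2 hγ0).exists_eq_sum hn
  obtain ⟨d, hd⟩ := ((isPositiveRoot_iff hδ2).2 hδ0).exists_eq_sum hn
  have hcr : c r = 1 := by
    have := hϖ.dotProduct_sum c
    rw [← hc, hγϖ] at this
    omega
  have hdr : d r = 1 := by
    have := hϖ.dotProduct_sum d
    rw [← hd, hδϖ] at this
    omega
  have hXr : (c - d) r = 0 := by simp [hcr, hdr]
  have hYr : (d - c) r = 0 := by simp [hcr, hdr]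
  have hdiff : γ - δ = ∑ i, (c - d) i • simpleRoot i - ∑ i, (d - c) i • simpleRoot i := by
    rw [hc, hd, sum_tsub_sub_sum_tsub]
  have hwXY : rho ⬝ᵥ w (∑ i, (c - d) i • simpleRoot i) =
      rho ⬝ᵥ w (∑ i, (d - c) i • simpleRoot i) := by
    have := congrArg (fun v => rho ⬝ᵥ w v) hdiff
    simp only [map_sub, dotProduct_sub, hwγ, hwδ, dotProduct_neg, rho_simpleRoot hn] at this
    omega
  have hne : γ ≠ δ := fun h => by rw [← h, hγ2] at hγδ; omega
  -- Neither root dominates the other: `w` sends both of them to negatives of simple roots.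
  have hXY0 : c - d = 0 → d - c = 0 → False := fun hX hY => by
    rw [hX, hY, sub_self, sub_eq_zero] at hdiff
    exact hne hdiff
  have hX : c - d ≠ 0 := fun hX => hXY0 hX (hw.eq_zero_of_rho_sum_eq_zero hYr (by
    rw [← hwXY, hX]; simp))
  have hY : d - c ≠ 0 := fun hY => hXY0 (hw.eq_zero_of_rho_sum_eq_zero hXr (by
    rw [hwXY, hY]; simp)) hY
  obtain ⟨hX2, hY2⟩ := dotProduct_self_sum_tsub hn (hc ▸ hγ2) (hd ▸ hδ2) (hc ▸ hd ▸ hγδ) hX hY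
  have hXϖ := hϖ.dotProduct_sum (c - d)
  have hYϖ := hϖ.dotProduct_sum (d - c)
  have huY : 0 ≤ rho ⬝ᵥ u (∑ i, (d - c) i • simpleRoot i) := by
    refine IsMinimalRepresentative.rho_sum_nonneg (r := r) (fun i hi => ?_) hYr
    have hi2 := simpleRoot_dotProduct_self hn i
    refine (lt_or_gt_of_ne (rho_ne_zero (by rw [hu_iso, hi2]))).resolve_left fun hneg => ?_
    have := h.rho_neg_of_suffix hn hi2 (by rw [rho_simpleRoot hn]; norm_num) hneg
    exact this.not_gt (hw i hi)
  rw [hXr] at hXϖ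
  rw [hYr] at hYϖ
  generalize ∑ i, (c - d) i • simpleRoot i = X at *
  generalize ∑ i, (d - c) i • simpleRoot i = Y at *
  have h1 : γ ⬝ᵥ X ≤ 1 := dotProduct_le_one hγ2 hX2 fun h => by rw [← h, hγϖ] at hXϖ; omega
  have h2 : γ ⬝ᵥ -Y ≤ 1 := dotProduct_le_one hγ2 (by simpa using hY2) fun h => by
    rw [← neg_eq_iff_eq_neg] at h
    rw [← h, dotProduct_neg, hγϖ] at hYϖ
    omega
  have h3 : γ ⬝ᵥ X - γ ⬝ᵥ Y = 2 := by
    rw [← dotProduct_sub, ← hdiff, dotProduct_sub, hγ2, hγδ, sub_zero]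
  rw [dotProduct_neg] at h2
  -- The meet `μ = γ - X = δ - Y` is an inversion of `u`, hence orthogonal to `γ`.
  have hμ2 : (γ - X) ⬝ᵥ (γ - X) = 2 := by
    rw [sub_dotProduct, dotProduct_sub, dotProduct_sub, dotProduct_comm X γ, hγ2, hX2]
    omega
  have hμδ : γ - X = δ - Y := by rw [sub_eq_sub_iff_sub_eq_sub, hdiff]
  have hμ0 : 0 < rho ⬝ᵥ (γ - X) := by
    refine (lt_or_gt_of_ne (rho_ne_zero hμ2)).resolve_left fun hneg => ?_
    have := hϖ.dotProduct_nonneg hn (v := -(γ - X)) (by rwa [neg_dotProduct_neg])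
      (by rw [dotProduct_neg]; omega)
    rw [dotProduct_neg, dotProduct_sub, hγϖ, hXϖ] at this
    norm_num at this
  have huμ : rho ⬝ᵥ u (γ - X) < 0 := by
    rw [hμδ, map_sub, huδ, dotProduct_sub, dotProduct_neg, rho_simpleRoot hn]
    omega
  obtain ⟨p, e, s, hsplit, hp⟩ := exists_split_of_rho_inv_neg hn (l := b :: l')
    (v := -u (γ - X)) (by rw [neg_dotProduct_neg, hu_iso, hμ2]) (by rw [dotProduct_neg]; omega)
    (by rw [← hu, map_neg, inv_apply_apply, dotProduct_neg]; omega)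
  have h4 : u (γ - X) ⬝ᵥ γ = 0 := by
    have h5 : wordProd hn p γ = γ := wordProd_apply_of_orthogonal hn fun f hf =>
      horth' f (by rw [hsplit]; exact List.mem_append_left _ hf)
    have h6 : wordProd hn p (simpleRoot e) ⬝ᵥ γ = 0 := by
      nth_rw 1 [← h5]
      rw [wordProd_dotProduct]
      exact horth' e (by rw [hsplit]; simp)
    rwa [← hp, neg_dotProduct, neg_eq_zero] at h6
  rw [← huγ, hu_iso, huγ, sub_dotProduct, hγ2, dotProduct_comm X γ] at h4
  omega

/-! ### The order of the quiver -/

theorem IsReducedWord.exists_between (hn : 4 ≤ n) {w : (Fin n → ℤ) ≃ₗ[ℤ] (Fin n → ℤ)}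
    {t : List (Fin n)} (h : IsReducedWord hn t w) {i j : Fin t.length} (hij : i < j)
    (heq : t.get i = t.get j) :
    ∃ l, i < l ∧ l < j ∧ simpleRoot (t.get l) ⬝ᵥ simpleRoot (t.get j) ≠ 0 := by
  have hij' : (i : ℕ) < j := hij
  have h1 : t = t.take i ++ t.get i :: (((t.drop (i + 1)).take (j - i - 1)) ++
      t.get j :: t.drop (j + 1)) := by
    have e1 : t.get j :: t.drop (j + 1) = (t.drop (i + 1)).drop (j - i - 1) := by
      rw [List.drop_drop, show (i : ℕ) + 1 + (j - i - 1) = j by omega, List.get_eq_getElem,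
        List.cons_getElem_drop_succ]
    rw [e1, List.take_append_drop, List.get_eq_getElem, List.cons_getElem_drop_succ,
      List.take_append_drop]
  rw [heq] at h1
  obtain ⟨d, hd, hd0⟩ := (h1 ▸ h).exists_nonorthogonal hn
  obtain ⟨k, hk, rfl⟩ := List.mem_iff_getElem.1 hd
  simp only [List.length_take, List.length_drop] at hk
  refine ⟨⟨i + 1 + k, by omega⟩, ?_, ?_, ?_⟩
  · exact Fin.mk_lt_mk.2 (by omega)
  · exact Fin.mk_lt_mk.2 (by omega)
  · simpa [List.getElem_take, List.getElem_drop] using hd0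

theorem QuiverOrder.le {t : List (Fin n)} {V : Set (Fin t.length)} {i j : Fin t.length}
    (h : QuiverOrder t V i j) : i ≤ j := by
  induction h with
  | refl => exact le_rfl
  | tail _ h ih => exact ih.trans h.2.2.2.1.le

theorem QuiverOrder.of_arrow {t : List (Fin n)} {i j : Fin t.length} (h : Arrow t i j) :
    QuiverOrder t Set.univ i j :=
  Relation.ReflTransGen.single ⟨trivial, trivial, h⟩

/-- In a reduced word, a position lies below every later position with a non-orthogonal letter.
When the two letters are equal, or their arrow is cut off by a successor, the path passes
through the positions between a letter and its successor. -/
theorem IsReducedWord.quiverOrder_of_lt (hn : 4 ≤ n) {w : (Fin n → ℤ) ≃ₗ[ℤ] (Fin n → ℤ)}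
    {t : List (Fin n)} (h : IsReducedWord hn t w) {i j : Fin t.length} (hij : i < j)
    (h0 : simpleRoot (t.get j) ⬝ᵥ simpleRoot (t.get i) ≠ 0) : QuiverOrder t Set.univ i j := by
  induction i using WellFoundedGT.induction with
  | ind i ih =>
  by_cases hs : ∀ s, IsSuccessor t i s → j < s
  · exact QuiverOrder.of_arrow ⟨h0, hij, hs⟩
  push Not at hs
  obtain ⟨s, hs, hsj⟩ := hs
  have his : i < s := hs.1.1
  have hts : t.get s = t.get i := hs.1.2
  have hpath : QuiverOrder t Set.univ i s := by
    obtain ⟨l, ⟨hil, hls, hl0⟩, hmax⟩ := Set.Finite.exists_maximal (Set.toFinite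
      {l | i < l ∧ l < s ∧ simpleRoot (t.get l) ⬝ᵥ simpleRoot (t.get s) ≠ 0})
      (h.exists_between hn his hts.symm)
    refine (QuiverOrder.of_arrow ⟨hts ▸ hl0, hil, fun s' hs' => ?_⟩).trans
      (QuiverOrder.of_arrow ⟨by rwa [dotProduct_comm], hls, fun s' hs' => ?_⟩)
    · exact hls.trans_le (hs.2 hs'.1)
    · by_contra! hle
      have hls' : l < s' := hs'.1.1
      rcases hle.lt_or_eq with hlt | rfl
      · have := hmax ⟨hil.trans hls', hlt, by rwa [hs'.1.2]⟩ hls'.le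
        exact this.not_gt hls'
      · exact hls.not_ge (hs.2 ⟨hil, by rw [← hs'.1.2, hts]⟩)
  rcases hsj.lt_or_eq with hlt | rfl
  · exact hpath.trans (ih s his hlt (by rwa [hts]))
  · exact hpath

/-! ### The first piece of the quiver -/

theorem length_pieces (t : List (Fin n)) (V : Set (Fin t.length)) (ps : List (Fin t.length)) :
    (pieces t V ps).length = ps.length := by
  induction ps generalizing V with
  | nil => rfl
  | cons p ps ih => rw [pieces, List.length_cons, List.length_cons, ih]

theorem exists_arrow_of_notMem_peaks {t : List (Fin n)} {i : Fin t.length}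
    (h : i ∉ peaks t Set.univ) : ∃ j, Arrow t j i := by
  simp only [peaks, Set.mem_univ, true_and, Set.mem_ofPred_eq, true_imp_iff] at h
  push Not at h
  obtain ⟨j, hj, hne⟩ := h
  rcases Relation.ReflTransGen.cases_tail hj with h | ⟨k, -, hk⟩
  · exact absurd h.symm hne
  · exact ⟨k, hk.2.2⟩

theorem mem_subquiver_univ {t : List (Fin n)} {p i : Fin t.length} :
    i ∈ subquiver t Set.univ {p} ↔
      ∀ j ∈ peaks t Set.univ, j ≠ p → ¬ QuiverOrder t Set.univ j i := by
  simp [subquiver]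

theorem mem_subquiver_self {t : List (Fin n)} {p : Fin t.length} (hp : p ∈ peaks t Set.univ) :
    p ∈ subquiver t Set.univ {p} :=
  mem_subquiver_univ.2 fun j _ hjp hle => hjp (hp.2 j trivial hle)

/-- The only vertex of `Q(p)` all of whose predecessors in `Q(p)` are orthogonal to it is the
peak `p`. -/
theorem eq_of_forall_lt_orthogonal {t : List (Fin n)} {p i : Fin t.length}
    (hi : i ∈ subquiver t Set.univ {p})
    (h : ∀ j ∈ subquiver t Set.univ {p}, j < i →
      simpleRoot (t.get j) ⬝ᵥ simpleRoot (t.get i) = 0) : i = p := by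
  rw [mem_subquiver_univ] at hi
  by_contra hne
  obtain ⟨j, hj⟩ := exists_arrow_of_notMem_peaks (i := i) fun hpeak =>
    hi i hpeak hne Relation.ReflTransGen.refl
  refine hj.1 ?_
  rw [dotProduct_comm]
  exact h j (mem_subquiver_univ.2 fun k hk hkp hle =>
    hi k hk hkp (hle.trans (QuiverOrder.of_arrow hj))) hj.2.1

theorem IsReducedWord.orthogonal_of_notMem_of_mem (hn : 4 ≤ n)
    {w : (Fin n → ℤ) ≃ₗ[ℤ] (Fin n → ℤ)} {t : List (Fin n)} (ht : IsReducedWord hn t w)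
    {p i j : Fin t.length} (hij : i < j) (hi : i ∉ subquiver t Set.univ {p})
    (hj : j ∈ subquiver t Set.univ {p}) :
    simpleRoot (t.get i) ⬝ᵥ simpleRoot (t.get j) = 0 := by
  rw [mem_subquiver_univ] at hi hj
  push Not at hi
  obtain ⟨k, hk, hkp, hle⟩ := hi
  by_contra h0
  exact hj k hk hkp (hle.trans (ht.quiverOrder_of_lt hn hij (by rwa [dotProduct_comm])))

/-- The first vertex outside `Q(p)` is another peak, so its letter commutes with all of `Q(p)`. -/
theorem IsReducedWord.orthogonal_of_first_notMem (hn : 4 ≤ n)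
    {w : (Fin n → ℤ) ≃ₗ[ℤ] (Fin n → ℤ)} {t : List (Fin n)} (ht : IsReducedWord hn t w)
    {p q : Fin t.length} (hq : q ∉ subquiver t Set.univ {p})
    (hfirst : ∀ k, k ∉ subquiver t Set.univ {p} → q ≤ k) {i : Fin t.length}
    (hi : i ∈ subquiver t Set.univ {p}) :
    simpleRoot (t.get i) ⬝ᵥ simpleRoot (t.get q) = 0 := by
  have hpeak : q ∈ peaks t Set.univ := by
    have hq' := hq
    rw [mem_subquiver_univ] at hq'
    push Not at hq'
    obtain ⟨k, hk, hkp, hle⟩ := hq'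
    have hkV : k ∉ subquiver t Set.univ {p} := fun h =>
      mem_subquiver_univ.1 h k hk hkp Relation.ReflTransGen.refl
    rwa [(hfirst k hkV).antisymm hle.le]
  rcases lt_trichotomy i q with hlt | rfl | hlt
  · by_contra h0
    exact hlt.ne (hpeak.2 i trivial (ht.quiverOrder_of_lt hn hlt (by rwa [dotProduct_comm])))
  · exact absurd hi hq
  · rw [dotProduct_comm]
    exact ht.orthogonal_of_notMem_of_mem hn hlt hq hi

open Classical in
/-- The letters of the word `t` at the positions in `V`, in increasing order. -/
noncomputable def subword (t : List (Fin n)) (V : Set (Fin t.length)) : List (Fin n) :=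
  ((List.finRange t.length).filter fun i => i ∈ V).map t.get

theorem pieceProd_eq (hn : 4 ≤ n) (t : List (Fin n)) (V : Set (Fin t.length)) :
    pieceProd hn t V = wordProd hn (subword t V) := rfl

theorem exists_mem_of_mem_subword {t : List (Fin n)} {V : Set (Fin t.length)} {c : Fin n}
    (hc : c ∈ subword t V) : ∃ i ∈ V, t.get i = c := by
  simpa [subword] using hc

theorem mem_subword {t : List (Fin n)} {V : Set (Fin t.length)} {i : Fin t.length}
    (hi : i ∈ V) : t.get i ∈ subword t V :=
  List.mem_map_of_mem (by simpa using hi)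

theorem exists_position_of_subword_eq {t : List (Fin n)} {V : Set (Fin t.length)}
    {l l' : List (Fin n)} {c : Fin n} (h : subword t V = l ++ c :: l') :
    ∃ q ∈ V, t.get q = c ∧ ∀ i ∈ V, i < q → t.get i ∈ l := by
  classical
  obtain ⟨A, B, hAB, rfl, hB⟩ := List.map_eq_append_iff.1 h
  obtain ⟨q, B, rfl, rfl, rfl⟩ := List.map_eq_cons_iff.1 hB
  have hmem : ∀ i, i ∈ V ↔ i ∈ A ++ q :: B := fun i => by simp [← hAB]
  refine ⟨q, (hmem q).2 (by simp), rfl, fun i hi hiq => ?_⟩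
  have hsorted : (A ++ q :: B).Pairwise (· < ·) := by
    rw [← hAB]
    exact (List.pairwise_lt_finRange _).filter _
  rcases List.mem_append.1 ((hmem i).1 hi) with h | h
  · exact List.mem_map_of_mem h
  · have h2 := (List.pairwise_append.1 hsorted).2.1
    rcases List.mem_cons.1 h with rfl | h
    · exact absurd hiq (lt_irrefl _)
    · exact absurd ((List.pairwise_cons.1 h2).1 i h) hiq.not_gt

theorem length_subword_add_length_subword_compl (t : List (Fin n)) (V : Set (Fin t.length)) :
    (subword t V).length + (subword t Vᶜ).length = t.length := by
  classical
  simp only [subword, List.length_map]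
  conv_rhs => rw [← List.length_finRange (n := t.length)]
  rw [List.length_eq_length_filter_add (l := List.finRange t.length) fun i => decide (i ∈ V)]
  congr 3
  funext i
  simp

theorem IsReducedWord.subword_append (hn : 4 ≤ n) {w : (Fin n → ℤ) ≃ₗ[ℤ] (Fin n → ℤ)}
    {t : List (Fin n)} (ht : IsReducedWord hn t w) (p : Fin t.length) :
    IsReducedWord hn (subword t (subquiver t Set.univ {p}) ++
      subword t (subquiver t Set.univ {p})ᶜ) w := by
  classical
  refine ⟨?_, fun t' ht' => ?_⟩
  · have := wordProd_filter_mul_wordProd_filter hn t.get (fun i => i ∈ subquiver t Set.univ {p})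
      (l := List.finRange t.length) ((List.pairwise_lt_finRange _).imp fun hij hi hj =>
        ht.orthogonal_of_notMem_of_mem hn hij hi hj)
    rw [List.map_get_finRange, ht.1] at this
    rw [wordProd_append, ← this]
    simp only [subword, Set.mem_compl_iff]
  · rw [List.length_append, length_subword_add_length_subword_compl]
    exact ht.2 t' ht'

end TypeD

theorem proposition4p11 (n : ℕ) (hn : 4 ≤ n) (r : Fin n) (hr : TypeD.IsMinusculeIndex r)
    (w : (Fin n → ℤ) ≃ₗ[ℤ] (Fin n → ℤ)) (hw : w ∈ TypeD.weylGroup hn)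
    (hwr : TypeD.stableSimpleRoots w = {r}ᶜ)
    (w₁ : (Fin n → ℤ) ≃ₗ[ℤ] (Fin n → ℤ)) (ws : List ((Fin n → ℤ) ≃ₗ[ℤ] (Fin n → ℤ)))
    (hdec : TypeD.IsConstructionOne hn w (w₁ :: ws)) :
    (∃! a : Fin n, TypeD.IsNegativeRoot (w₁⁻¹ (TypeD.simpleRoot a))) ∧
    ∀ a : Fin n, TypeD.IsNegativeRoot (w₁⁻¹ (TypeD.simpleRoot a)) →
      TypeD.RootLE (w⁻¹ (TypeD.simpleRoot a)) (w₁⁻¹ (TypeD.simpleRoot a)) ∧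
      (w₁⁻¹ (TypeD.simpleRoot a) = w⁻¹ (TypeD.simpleRoot a) ↔ w = w₁) ∧
      (w = w₁ ↔ (w₁ :: ws).length = 1) := by
  open TypeD in
  obtain ⟨ϖ, hϖ⟩ := hr.exists_weight hn
  have hmin : IsMinimalRepresentative w r := fun i hi => by
    have : i ∈ stableSimpleRoots w := by rw [hwr]; exact hi
    exact IsPositiveRoot.rho_pos this
  obtain ⟨t, order, ht, hnodup, hpeaks, hws⟩ := hdec
  rcases order with _ | ⟨p, ps⟩
  · simp [pieces] at hws
  rw [pieces, List.map_cons, List.cons.injEq, pieceProd_eq] at hws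
  obtain ⟨rfl, rfl⟩ := hws
  have hp : p ∈ peaks t Set.univ := (hpeaks p).1 List.mem_cons_self
  have hred := ht.subword_append hn p
  set V := subquiver t Set.univ {p} with hV
  have hlen := length_subword_add_length_subword_compl t V
  -- The first piece is the whole quiver if and only if `p` is the only peak.
  have hone : ∀ i, i ∉ V → ps ≠ [] := by
    rintro i hi rfl
    rw [hV, mem_subquiver_univ] at hi
    push Not at hi
    obtain ⟨j, hj, hjp, -⟩ := hi
    exact hjp (by simpa using (hpeaks j).2 hj)
  have hfull : (∀ i, i ∈ V) → ps = [] := by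
    intro hall
    refine List.eq_nil_iff_forall_not_mem.2 fun q hq => ?_
    have hqp : q ≠ p := fun h => (List.nodup_cons.1 hnodup).1 (h ▸ hq)
    exact mem_subquiver_univ.1 (hall q) q ((hpeaks q).1 (List.mem_cons_of_mem _ hq)) hqp
      Relation.ReflTransGen.refl
  have hnil : subword t Vᶜ = [] ↔ ∀ i, i ∈ V := by
    refine ⟨fun h i => ?_, fun h => List.eq_nil_iff_forall_not_mem.2 fun c hc => ?_⟩
    · by_contra hi
      have := mem_subword (V := Vᶜ) hi
      rw [h] at this
      exact List.not_mem_nil this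
    · obtain ⟨i, hi, -⟩ := exists_mem_of_mem_subword hc
      exact hi (h i)
  have heq_of_nil : subword t Vᶜ = [] → w = wordProd hn (subword t V) := fun h => by
    rw [← hred.1, h, List.append_nil]
  have hnil_of_eq : w = wordProd hn (subword t V) → subword t Vᶜ = [] := fun h => by
    have := ht.2 _ h.symm
    exact List.eq_nil_of_length_eq_zero (by omega)
  have hneg : ∀ a, IsNegativeRoot ((wordProd hn (subword t V))⁻¹ (simpleRoot a)) ↔
      rho ⬝ᵥ (wordProd hn (subword t V))⁻¹ (simpleRoot a) < 0 := fun a =>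
    isNegativeRoot_iff (by rw [wordProd_inv_dotProduct, simpleRoot_dotProduct_self hn])
  have hdesc : ∀ a, rho ⬝ᵥ (wordProd hn (subword t V))⁻¹ (simpleRoot a) < 0 → a = t.get p := by
    intro a ha
    obtain ⟨l, l', hl, horth⟩ := hred.exists_split_of_descent hn hmin hϖ ha
    obtain ⟨q, hq, rfl, hqlt⟩ := exists_position_of_subword_eq hl
    rw [eq_of_forall_lt_orthogonal hq fun j hj hjq => horth _ (hqlt j hj hjq)]
  simp only [hneg]
  refine ⟨?_, fun a ha => ⟨?_, ⟨fun h => ?_, fun h => by rw [← h]⟩, fun h => ?_, fun h => ?_⟩⟩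
  · -- The first letter of the first piece is a left descent.
    obtain ⟨a, l, hl⟩ := List.exists_cons_of_ne_nil
      (List.ne_nil_of_mem (mem_subword (mem_subquiver_self hp)))
    have ha : rho ⬝ᵥ (wordProd hn (subword t V))⁻¹ (simpleRoot a) < 0 := by
      rw [← hV] at hl
      rw [hl] at hred ⊢
      have := IsReducedWord.rho_suffix_pos hn (p := []) (c := a) (s := l) (w := wordProd hn (a :: l))
        ⟨rfl, fun t' ht' => by
          have := hred.2 (t' ++ subword t Vᶜ) (by
            rw [wordProd_append, ht', ← wordProd_append, hred.1])
          simpa using this⟩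
      rw [wordProd_cons_inv_apply, simpleReflection_simpleRoot, map_neg, dotProduct_neg]
      omega
    exact ⟨a, ha, fun b hb => (hdesc b hb).trans (hdesc a ha).symm⟩
  · obtain ⟨k, hk, -⟩ := hred.exists_inv_eq_sub_sum hn hmin hϖ ha
    exact ⟨k, by rw [hk]; abel⟩
  · obtain ⟨k, hk, hk0⟩ := hred.exists_inv_eq_sub_sum hn hmin hϖ ha
    have hkzero : k = 0 := by
      rw [← h, eq_comm, sub_eq_self] at hk
      exact eq_zero_of_sum_simpleRoot_eq_zero hn hk
    refine heq_of_nil ?_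
    by_contra hne
    obtain ⟨b, l, hl⟩ := List.exists_cons_of_ne_nil hne
    obtain ⟨q, hq, rfl, hqlt⟩ := exists_position_of_subword_eq (l := []) hl
    rw [hl] at hred hk0
    refine hred.not_orthogonal hn hmin hϖ ha (fun c hc => ?_) (hk0 hkzero)
    obtain ⟨i, hi, rfl⟩ := exists_mem_of_mem_subword hc
    exact ht.orthogonal_of_first_notMem hn hq
      (fun k hk => le_of_not_gt fun hlt => List.not_mem_nil (hqlt k hk hlt)) hi
  · simp [length_pieces, hfull (hnil.1 (hnil_of_eq h))]
  · have hps : ps = [] := by simpa [length_pieces] using h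
    exact heq_of_nil (hnil.2 fun i => by_contra fun hi => hone i hi hps)
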